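/- Let $d\ge 1$ and $p\in(0,1)$. Equip the set $\mathrm{Part}$ of partitions of $\mathbb{Z}^d$ with the $\sigma$-algebra generated by the maps $\pi\mapsto\pi_K$, $K\subset\mathbb{Z}^d$ finite, where $\pi_K$ is the partition of $K$ induced by $\pi$, and let $\nu$ be a translation invariant probability measure on $\mathrm{Part}$. Let $\mathbf{P}_{\nu,p}$ be the law of the pair $(\pi,X)\in\mathrm{Part}\times\{0,1\}^{\mathbb{Z}^d}$ obtained as follows: $\pi$ has law $\nu$ and, given $\pi$, independently for different elements (clusters) $\phi$ of $\pi$, all vertices of $\phi$ receive the value $X=1$ with probability $p$ and all of them receive the value $X=0$ with probability $1-p$. Let $\Phi_p(\nu)$ be the law of $X$. Write $B_n=[-n,n]^d\cap\mathbb{Z}^d$, and say that $S\subseteq\mathbb{Z}^d$ has positive density if $\lim_{n\to\infty}|S\cap B_n|/|B_n|$ exists and is positive. A probability measure $\mu$ that is invariant under an action $(T^x)_{x\in\mathbb{Z}^d}$ is called weakly mixing if $$\lim_{n\to\infty}\frac1{|B_n|}\sum_{x\in B_n}\bigl|\mu(A\cap T^{-x}B)-\mu(A)\mu(B)\bigr|=0\quad\text{for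 all measurable sets } A,B;$$ here the action is always the one by translations. Assume that $$\nu(\exists\,\phi\in\pi:\ \phi\text{ has positive density})=0 .$$ Then $\nu$ is weakly mixing if and only if $\mathbf{P}_{\nu,p}$ is weakly mixing. In particular, if $\nu$ is weakly mixing, then $\Phi_p(\nu)$ is weakly mixing. -/

import Mathlib

open MeasureTheory ProbabilityTheory Filter Topology

noncomputable section

namespace RandomColoring

/-- A partition of `V` is encoded as an equivalence relation `π : Setoid V`. The σ-algebra on the set
of partitions of `V` is the one generated by the maps `π ↦ π_K`, where `K ⊆ V` is finite and `π_K` is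
the induced partition of `K` (the finite set of partitions of `K` carries the discrete σ-algebra). -/
instance partitionMeasurableSpace {V : Type*} : MeasurableSpace (Setoid V) :=
  ⨆ K : Finset V,
    MeasurableSpace.comap (fun π : Setoid V => Setoid.comap (Subtype.val : K → V) π) ⊤

/-- Given a partition `π`, the law of the coloring obtained by choosing, independently for the
clusters of `π`, a color which is `1` with probability `p` and `0` with probability `1 - p`, and by
giving to every vertex the color of its cluster. -/
def colorLaw {V : Type*} (p : unitInterval) (π : Setoid V) : Measure (V → Fin 2) :=
  (Measure.infinitePi fun _ : Quotient π => bernoulliMeasure (1 : Fin 2) 0 p).map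
    fun c v => c (Quotient.mk π v)

theorem measurableSet_rel {V : Type*} (u v : V) : MeasurableSet {π : Setoid V | π u v} := by
  classical
  have hle : MeasurableSpace.comap
      (fun π : Setoid V => Setoid.comap (Subtype.val : ({u, v} : Finset V) → V) π) ⊤
      ≤ (partitionMeasurableSpace : MeasurableSpace (Setoid V)) :=
    le_iSup (fun K : Finset V => MeasurableSpace.comap
      (fun π : Setoid V => Setoid.comap (Subtype.val : K → V) π) ⊤) {u, v}
  apply hle
  exact ⟨{σ | σ ⟨u, by simp⟩ ⟨v, by simp⟩}, trivial, rfl⟩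

/-- A representative of the cluster of `v`: its first element in an enumeration of `V`. It only
serves to prove that the law of the coloring depends measurably on the partition. -/
theorem exists_rep (V : Type*) [Countable V] :
    ∃ rep : Setoid V → V → V, (∀ (π : Setoid V) (v : V), π (rep π v) v) ∧
      (∀ (π : Setoid V) (u v : V), π u v → rep π u = rep π v) ∧
      ∀ v w, MeasurableSet {π : Setoid V | rep π v = w} := by
  classical
  let _ : Encodable V := Encodable.ofCountable V
  have hex : ∀ (π : Setoid V) (v : V), ∃ n : ℕ, ∃ u : V, Encodable.encode u = n ∧ π u v :=
    fun π v => ⟨_, v, rfl, π.refl v⟩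
  choose rep hrep using fun (π : Setoid V) (v : V) => Nat.find_spec (hex π v)
  have hmin : ∀ (π : Setoid V) (v u : V), π u v →
      Encodable.encode (rep π v) ≤ Encodable.encode u := by
    intro π v u hu
    rw [(hrep π v).1]
    exact Nat.find_min' _ ⟨u, rfl, hu⟩
  have hchar : ∀ (π : Setoid V) (v w : V), rep π v = w ↔
      (π w v ∧ ∀ u : V, Encodable.encode u < Encodable.encode w → ¬ π u v) := by
    intro π v w
    constructor
    · rintro rfl
      exact ⟨(hrep π v).2, fun u hu h => absurd (hmin π v u h) (not_le.mpr hu)⟩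
    · rintro ⟨h1, h2⟩
      apply Encodable.encode_injective
      refine le_antisymm (hmin π v w h1) (not_lt.mp fun hlt => h2 _ hlt (hrep π v).2)
  refine ⟨rep, fun π v => (hrep π v).2, ?_, ?_⟩
  · intro π u v huv
    rw [hchar]
    exact ⟨π.trans (hrep π v).2 (π.symm huv),
      fun x hx hxu => absurd (hmin π v x (π.trans hxu huv)) (not_le.mpr hx)⟩
  · intro v w
    simp_rw [hchar]
    have : {π : Setoid V | π w v ∧ ∀ u : V, Encodable.encode u < Encodable.encode w → ¬ π u v}
        = {π : Setoid V | π w v} ∩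
          ⋂ u : V, ⋂ _ : Encodable.encode u < Encodable.encode w, {π : Setoid V | π u v}ᶜ := by
      ext π
      simp
    rw [this]
    exact (measurableSet_rel w v).inter
      (MeasurableSet.iInter fun u => MeasurableSet.iInter fun _ => (measurableSet_rel u v).compl)

theorem measurable_colorLaw {V : Type*} [Countable V] (p : unitInterval) :
    Measurable (colorLaw p : Setoid V → Measure (V → Fin 2)) := by
  classical
  obtain ⟨rep, hrep, hcongr, hmeas⟩ := exists_rep V
  set b : Measure (Fin 2) := bernoulliMeasure (1 : Fin 2) 0 p with hb
  have hmk : ∀ (π : Setoid V) (v : V), Quotient.mk π (rep π v) = Quotient.mk π v :=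
    fun π v => Quotient.sound (hrep π v)
  have key : ∀ π : Setoid V, colorLaw p π =
      (Measure.infinitePi fun _ : V => b).map (fun y v => y (rep π v)) := by
    intro π
    let j : Quotient π → V := Quotient.lift (rep π) (fun u v h => hcongr π u v h)
    have hj : ∀ q : Quotient π, Quotient.mk π (j q) = q := by
      intro q
      induction q using Quotient.inductionOn with
      | h v => exact hmk π v
    have hmap : (Measure.infinitePi fun _ : V => b).map (fun y (q : Quotient π) => y (j q)) =
        Measure.infinitePi fun _ : Quotient π => b := by
      refine Measure.eq_infinitePi _ fun s t ht => ?_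
      rw [Measure.map_apply (by fun_prop) (MeasurableSet.pi s.countable_toSet fun i _ => ht i)]
      have : (fun (y : V → Fin 2) (q : Quotient π) => y (j q)) ⁻¹' (Set.pi (s : Set _) t) =
          Set.pi ((s.image j : Finset V) : Set V) (fun v => t (Quotient.mk π v)) := by
        ext y
        simp [Set.mem_pi, hj]
      rw [this, Measure.infinitePi_pi _ fun i _ => ht _, Finset.prod_image]
      · simp [hj]
      · intro q _ q' _ h
        rw [← hj q, ← hj q', h]
    unfold colorLaw
    rw [← hb, ← hmap, Measure.map_map (by fun_prop) (by fun_prop)]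
    rfl
  have hjoint : Measurable fun x : Setoid V × (V → Fin 2) => fun v => x.2 (rep x.1 v) := by
    refine measurable_pi_lambda _ fun v => ?_
    refine measurable_to_countable' fun a => ?_
    have : (fun x : Setoid V × (V → Fin 2) => x.2 (rep x.1 v)) ⁻¹' {a} =
        ⋃ w : V, {π : Setoid V | rep π v = w} ×ˢ {y : V → Fin 2 | y w = a} := by
      ext x
      simp
    rw [this]
    exact MeasurableSet.iUnion fun w => (hmeas v w).prod
      (measurable_pi_apply (X := fun _ : V => Fin 2) w (measurableSet_singleton a))
  refine Measure.measurable_of_measurable_coe _ fun s hs => ?_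
  have hslice := measurable_measure_prodMk_left
    (ν := (Measure.infinitePi fun _ : V => b)) (hjoint hs)
  convert hslice using 2 with π
  rw [key, Measure.map_apply (by fun_prop) hs]
  rfl

/-- `colorLaw` as a Markov kernel from partitions to colorings. -/
def colorKernel (V : Type*) [Countable V] (p : unitInterval) : Kernel (Setoid V) (V → Fin 2) where
  toFun := colorLaw p
  measurable' := measurable_colorLaw p

/-- The joint law `P_{ν,p}` of the random partition `π` (with law `ν`) and of the associated
coloring `X^{ν,p}`. -/
def jointLaw {V : Type*} [Countable V] (p : unitInterval) (ν : Measure (Setoid V)) :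
    Measure (Setoid V × (V → Fin 2)) :=
  ν ⊗ₘ colorKernel V p

/-- The color process `Φ_p(ν)`: the law of the coloring `X^{ν,p}`. -/
def colorProcess {V : Type*} [Countable V] (p : unitInterval) (ν : Measure (Setoid V)) :
    Measure (V → Fin 2) :=
  (jointLaw p ν).snd

/-- Translation by `x` of a partition of `ℤ^d`: the clusters of the new partition are the sets
`A + x` with `A` a cluster of `π`. -/
def shiftPartition {d : ℕ} (x : Fin d → ℤ) (π : Setoid (Fin d → ℤ)) : Setoid (Fin d → ℤ) :=
  Setoid.comap (fun y => y - x) π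

/-- Translation by `x` of a coloring of `ℤ^d`. -/
def shiftColoring {d : ℕ} (x : Fin d → ℤ) (ω : (Fin d → ℤ) → Fin 2) : (Fin d → ℤ) → Fin 2 :=
  fun y => ω (y - x)

/-- Translation by `x` of a pair consisting of a partition and a coloring of `ℤ^d`. -/
def shiftJoint {d : ℕ} (x : Fin d → ℤ) :
    Setoid (Fin d → ℤ) × ((Fin d → ℤ) → Fin 2) → Setoid (Fin d → ℤ) × ((Fin d → ℤ) → Fin 2) :=
  Prod.map (shiftPartition x) (shiftColoring x)

/-- The box `[-n, n]^d ∩ ℤ^d`. -/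
def box (d n : ℕ) : Finset (Fin d → ℤ) :=
  Finset.Icc (fun _ => -(n : ℤ)) (fun _ => (n : ℤ))

/-- The measure `μ` is invariant under the maps `T x`, `x ∈ ℤ^d`. -/
def IsStationary {d : ℕ} {Ω : Type*} [MeasurableSpace Ω] (T : (Fin d → ℤ) → Ω → Ω)
    (μ : Measure Ω) : Prop :=
  ∀ x, MeasurePreserving (T x) μ μ

/-- The `ℤ^d`-action `T` on the probability space `(Ω, μ)` is measure preserving and weakly mixing:
`μ (A ∩ T_x⁻¹ B) - μ A * μ B` tends to `0` in absolute Cesàro mean along the boxes `[-n, n]^d`. -/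
structure IsWeaklyMixing {d : ℕ} {Ω : Type*} [MeasurableSpace Ω] (T : (Fin d → ℤ) → Ω → Ω)
    (μ : Measure Ω) : Prop where
  stationary : IsStationary T μ
  tendsto_zero : ∀ A B : Set Ω, MeasurableSet A → MeasurableSet B →
    Tendsto (fun n : ℕ =>
      (∑ x ∈ box d n, |μ.real (A ∩ T x ⁻¹' B) - μ.real A * μ.real B|) / ((box d n).card : ℝ))
      atTop (𝓝 0)

/-- The set `S ⊆ ℤ^d` has density `α`. -/
def HasDensity {d : ℕ} (S : Set (Fin d → ℤ)) (α : ℝ) : Prop :=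
  Tendsto (fun n : ℕ => ((S ∩ (box d n : Set (Fin d → ℤ))).ncard : ℝ) / ((box d n).card : ℝ))
    atTop (𝓝 α)

end RandomColoring

end

/-! The partition is a factor of the pair, so mixing of the pair passes to `ν`; likewise the
coloring is a factor of the pair. The content is that mixing of `ν` passes to the pair.

Given `π`, all of `K` has color 1 with probability `p ^ clusterCount π K`. If no cluster meets both
`K` and the translate `L - x`, the exponent for `K ∪ (L - x)` is the sum of the two exponents, so
the joint probability is an integral of a function of `π` times a function of the translate of `π`
by `x`; mixing of `ν`, applied to level sets of the counts, decorrelates them. The error is at most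
the sum over `u ∈ K`, `v ∈ L` of `ν {π | π u (v - x)}` (`abs_jointLaw_sub_le`), and it must vanish
in Cesàro mean.

That mean is the expected proportion of a box that lies in one cluster. The hypothesis excludes
clusters having a positive density, but not clusters without density, so existence of densities must
be proved (`ae_exists_hasDensity`). By the pointwise ergodic theorem for the pair
(`ae_exists_tendsto_boxAvg`), color 1 almost surely has a density. Since `0 < p < 1`, this still
holds after forcing one cluster to be 1, or to be 0; the difference of the two densities is the
density of that cluster. Dominated convergence concludes.

The ergodic theorem follows from a minimal-norm argument in `L²` and a maximal inequality obtained
from Vitali covering. -/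

noncomputable section

namespace RandomColoring

/-! ### Boxes, averages over boxes, and a covering inequality. -/

section Box

variable {d : ℕ}

theorem mem_box {n : ℕ} {x : Fin d → ℤ} : x ∈ box d n ↔ ∀ i, -(n : ℤ) ≤ x i ∧ x i ≤ n := by
  simp only [box, Finset.mem_Icc, Pi.le_def, forall_and]

theorem card_box (n : ℕ) : (box d n).card = (2 * n + 1) ^ d := by
  have h : ((n : ℤ) + 1 + (n : ℤ)).toNat = 2 * n + 1 := by omega
  simp [box, Pi.card_Icc, h]

theorem card_box_pos (n : ℕ) : 0 < (box d n).card := by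
  rw [card_box]
  positivity

theorem card_box_mul_le (k n : ℕ) (hk : 1 ≤ k) :
    (box d (k * n)).card ≤ k ^ d * (box d n).card := by
  rw [card_box, card_box, ← mul_pow]
  exact Nat.pow_le_pow_left (by nlinarith) d

theorem box_mono {m n : ℕ} (h : m ≤ n) : box d m ⊆ box d n := by
  intro x hx
  rw [mem_box] at hx ⊢
  intro i
  have := hx i
  omega

theorem zero_mem_box (n : ℕ) : (0 : Fin d → ℤ) ∈ box d n := by
  simp [mem_box]

theorem neg_mem_box {n : ℕ} {x : Fin d → ℤ} : -x ∈ box d n ↔ x ∈ box d n := by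
  simp only [mem_box, Pi.neg_apply]
  exact forall_congr' fun i => by omega

theorem add_mem_box {m n : ℕ} {x y : Fin d → ℤ} (hx : x ∈ box d m) (hy : y ∈ box d n) :
    x + y ∈ box d (m + n) := by
  rw [mem_box] at *
  intro i
  have := hx i
  have := hy i
  simp only [Pi.add_apply]
  omega

theorem sub_mem_box {m n : ℕ} {x y : Fin d → ℤ} (hx : x ∈ box d m) (hy : y ∈ box d n) :
    x - y ∈ box d (m + n) := by
  rw [sub_eq_add_neg]
  exact add_mem_box hx (neg_mem_box.2 hy)

theorem exists_mem_box (w : Fin d → ℤ) : ∃ m, w ∈ box d m := by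
  refine ⟨∑ i, (w i).natAbs, mem_box.2 fun i => ?_⟩
  have := Finset.single_le_sum (f := fun i => (w i).natAbs) (fun _ _ => Nat.zero_le _)
    (Finset.mem_univ i)
  omega

theorem sum_box_neg {M : Type*} [AddCommMonoid M] (n : ℕ) (a : (Fin d → ℤ) → M) :
    ∑ x ∈ box d n, a (-x) = ∑ x ∈ box d n, a x :=
  Finset.sum_bij (fun x _ => -x) (fun _ h => neg_mem_box.2 h) (fun _ _ _ _ h => neg_injective h)
    (fun x h => ⟨-x, neg_mem_box.2 h, neg_neg x⟩) fun _ _ => rfl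

/-- The average of `a` over the box `[-n, n]^d`. -/
def boxAvg (n : ℕ) (a : (Fin d → ℤ) → ℝ) : ℝ :=
  (∑ x ∈ box d n, a x) / ((box d n).card : ℝ)

theorem boxAvg_neg (n : ℕ) (a : (Fin d → ℤ) → ℝ) : boxAvg n (fun x => a (-x)) = boxAvg n a := by
  rw [boxAvg, boxAvg, sum_box_neg]

theorem boxAvg_const (n : ℕ) (c : ℝ) : boxAvg n (fun _ : Fin d → ℤ => c) = c := by
  have : ((box d n).card : ℝ) ≠ 0 := by exact_mod_cast (card_box_pos n).ne'
  simp only [boxAvg, Finset.sum_const, nsmul_eq_mul]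
  field_simp

theorem boxAvg_add (n : ℕ) (a b : (Fin d → ℤ) → ℝ) :
    boxAvg n (fun x => a x + b x) = boxAvg n a + boxAvg n b := by
  simp only [boxAvg, Finset.sum_add_distrib, add_div]

theorem boxAvg_sub (n : ℕ) (a b : (Fin d → ℤ) → ℝ) :
    boxAvg n (fun x => a x - b x) = boxAvg n a - boxAvg n b := by
  simp only [boxAvg, Finset.sum_sub_distrib, sub_div]

theorem boxAvg_const_mul (n : ℕ) (c : ℝ) (a : (Fin d → ℤ) → ℝ) :
    boxAvg n (fun x => c * a x) = c * boxAvg n a := by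
  simp only [boxAvg, ← Finset.mul_sum, mul_div_assoc]

theorem boxAvg_sum {ι : Type*} (n : ℕ) (s : Finset ι) (a : ι → (Fin d → ℤ) → ℝ) :
    boxAvg n (fun x => ∑ i ∈ s, a i x) = ∑ i ∈ s, boxAvg n (a i) := by
  simp only [boxAvg, Finset.sum_div]
  exact Finset.sum_comm

theorem boxAvg_mono {n : ℕ} {a b : (Fin d → ℤ) → ℝ} (h : ∀ x, a x ≤ b x) :
    boxAvg n a ≤ boxAvg n b :=
  div_le_div_of_nonneg_right (Finset.sum_le_sum fun x _ => h x) (Nat.cast_nonneg _)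

theorem boxAvg_nonneg {n : ℕ} {a : (Fin d → ℤ) → ℝ} (h : ∀ x, 0 ≤ a x) : 0 ≤ boxAvg n a :=
  div_nonneg (Finset.sum_nonneg fun x _ => h x) (Nat.cast_nonneg _)

theorem abs_boxAvg_le (n : ℕ) (a : (Fin d → ℤ) → ℝ) : |boxAvg n a| ≤ boxAvg n fun x => |a x| := by
  rw [boxAvg, abs_div, Nat.abs_cast]
  exact div_le_div_of_nonneg_right (Finset.abs_sum_le_sum_abs _ _) (Nat.cast_nonneg _)

theorem tendsto_boxAvg_zero_of_le {a b : (Fin d → ℤ) → ℝ} (ha : ∀ x, 0 ≤ a x)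
    (h : ∀ x, a x ≤ b x) (hb : Tendsto (fun n => boxAvg n b) atTop (𝓝 0)) :
    Tendsto (fun n => boxAvg n a) atTop (𝓝 0) :=
  squeeze_zero (fun _ => boxAvg_nonneg ha) (fun _ => boxAvg_mono h) hb

/-- The averages over boxes of a bounded function are asymptotically translation invariant. -/
theorem tendsto_boxAvg_shift_sub {a : (Fin d → ℤ) → ℝ} {C : ℝ} (ha : ∀ x, |a x| ≤ C)
    (w : Fin d → ℤ) :
    Tendsto (fun n => boxAvg n (fun x => a (x + w)) - boxAvg n a) atTop (𝓝 0) := by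
  obtain ⟨m, hm⟩ := exists_mem_box w
  rw [← tendsto_add_atTop_iff_nat m]
  -- Both `box d (n + m)` and its translate by `w` contain `box d n`, so each sum differs from the
  -- sum over `box d n` by at most `C` times the number of extra points.
  have hinner : ∀ (n : ℕ) (s : Finset (Fin d → ℤ)), box d n ⊆ s →
      s.card = (box d (n + m)).card → |∑ x ∈ s, a x - ∑ x ∈ box d n, a x|
        ≤ C * ((box d (n + m)).card - (box d n).card) := by
    intro n s hs hc
    rw [← Finset.sum_sdiff hs, add_sub_cancel_right]
    refine (Finset.abs_sum_le_sum_abs _ _).trans ((Finset.sum_le_sum fun x _ => ha x).trans ?_)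
    rw [Finset.sum_const, nsmul_eq_mul, Finset.card_sdiff_of_subset hs,
      Nat.cast_sub (Finset.card_le_card hs), hc, mul_comm]
  have hbound : ∀ n : ℕ, |boxAvg (n + m) (fun x => a (x + w)) - boxAvg (n + m) a| ≤
      2 * C * (1 - ((2 * n + 1 : ℝ) / (2 * (n + m : ℕ) + 1)) ^ d) := by
    intro n
    have h1 := hinner n (box d (n + m)) (box_mono (Nat.le_add_right _ _)) rfl
    have h2 := hinner n ((box d (n + m)).map (addRightEmbedding w)) (by
      intro x hx
      rw [Finset.mem_map]
      exact ⟨x - w, sub_mem_box hx hm, by simp⟩) (by simp)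
    rw [Finset.sum_map] at h2
    simp only [addRightEmbedding_apply] at h2
    have hpos : (0 : ℝ) < (box d (n + m)).card := by exact_mod_cast card_box_pos _
    rw [boxAvg, boxAvg, ← sub_div, abs_div, Nat.abs_cast, div_le_iff₀ hpos]
    have h3 : 2 * C * (1 - ((2 * n + 1 : ℝ) / (2 * (n + m : ℕ) + 1)) ^ d) * (box d (n + m)).card
        = 2 * (C * ((box d (n + m)).card - (box d n).card)) := by
      have h4 : ((2 * n + 1 : ℝ) / (2 * (n + m : ℕ) + 1)) ^ d
          = (box d n).card / (box d (n + m)).card := by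
        rw [card_box, card_box, div_pow]
        push_cast
        rfl
      rw [h4]
      field_simp
    rw [h3]
    rw [abs_le] at *
    constructor <;> linarith [h1.1, h1.2, h2.1, h2.2]
  refine squeeze_zero_norm hbound ?_
  have hlim : Tendsto (fun n : ℕ => (2 * n + 1 : ℝ) / (2 * (n + m : ℕ) + 1)) atTop (𝓝 1) := by
    have h0 : Tendsto (fun n : ℕ => (2 * m : ℝ) / (2 * (n + m : ℕ) + 1)) atTop (𝓝 0) := by
      refine Tendsto.div_atTop tendsto_const_nhds ?_
      refine tendsto_atTop_mono (fun n => ?_) (tendsto_natCast_atTop_atTop (R := ℝ))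
      push_cast
      linarith [Nat.cast_nonneg (α := ℝ) n, Nat.cast_nonneg (α := ℝ) m]
    have h1 := (tendsto_const_nhds (x := (1 : ℝ))).sub h0
    rw [sub_zero] at h1
    refine h1.congr fun n => ?_
    have : (2 * (n + m : ℕ) + 1 : ℝ) ≠ 0 := by positivity
    field_simp
    push_cast
    ring
  have := ((hlim.pow d).const_sub 1).const_mul (2 * C)
  simpa using this

open scoped ENNReal

/-- A finite Vitali-type covering inequality for boxes centred at the points of `t`. -/
theorem mul_card_le_of_boxes (t W : Finset (Fin d → ℤ)) (r : (Fin d → ℤ) → ℕ)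
    (h : (Fin d → ℤ) → ℝ≥0∞) (l : ℝ≥0∞)
    (hl : ∀ x ∈ t, l * (box d (r x)).card ≤ ∑ y ∈ box d (r x), h (y + x))
    (hW : ∀ x ∈ t, ∀ y ∈ box d (r x), y + x ∈ W) :
    l * t.card ≤ 3 ^ d * ∑ y ∈ W, h y := by
  classical
  set B : (Fin d → ℤ) → Finset (Fin d → ℤ) := fun x => (box d (r x)).map (addRightEmbedding x)
    with hB
  have hmemB : ∀ {x y}, y ∈ B x ↔ y - x ∈ box d (r x) := by
    intro x y
    simp only [hB, Finset.mem_map, addRightEmbedding_apply]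
    exact ⟨by rintro ⟨z, hz, rfl⟩; simpa using hz, fun h => ⟨y - x, h, by simp⟩⟩
  have hsumB : ∀ x, ∑ y ∈ B x, h y = ∑ y ∈ box d (r x), h (y + x) := by
    intro x
    simp [hB, Finset.sum_map]
  obtain ⟨u, hut, hdisj, hcov⟩ := Vitali.exists_disjoint_subfamily_covering_enlargement
    (fun x => (B x : Set (Fin d → ℤ))) (t : Set (Fin d → ℤ)) (fun x => (r x : ℝ)) 2 one_lt_two
    (fun _ _ => Nat.cast_nonneg _) (t.sup r : ℕ)
    (fun x hx => by exact_mod_cast Finset.le_sup (f := r) hx)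
    (fun x _ => ⟨x, by
      rw [Finset.mem_coe, hmemB, sub_self]
      exact zero_mem_box _⟩)
  obtain ⟨u, rfl⟩ := (t.finite_toSet.subset hut).exists_finset_coe
  have hut' : u ⊆ t := by exact_mod_cast hut
  -- Only the centers in `t` need covering: if the boxes around `x` and `b` meet and `r x ≤ 2 * r
  -- b`, then `x - b` lies in the box of radius `r x + r b ≤ 3 * r b`.
  have hsub : t ⊆ u.biUnion fun b => (box d (3 * r b)).map (addRightEmbedding b) := by
    intro x hx
    obtain ⟨b, hb, ⟨z, hz1, hz2⟩, hle⟩ := hcov x hx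
    rw [Finset.mem_coe, hmemB] at hz1 hz2
    have hle' : r x ≤ 2 * r b := by exact_mod_cast hle
    rw [Finset.mem_biUnion]
    refine ⟨b, hb, ?_⟩
    rw [Finset.mem_map]
    refine ⟨x - b, ?_, by simp⟩
    have h1 := sub_mem_box hz2 hz1
    rw [sub_sub_sub_cancel_left] at h1
    exact box_mono (by omega) h1
  have hcard : t.card ≤ ∑ b ∈ u, 3 ^ d * (box d (r b)).card := by
    refine (Finset.card_le_card hsub).trans (Finset.card_biUnion_le.trans ?_)
    refine Finset.sum_le_sum fun b _ => ?_
    rw [Finset.card_map]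
    exact card_box_mul_le 3 (r b) (by norm_num)
  calc l * t.card ≤ l * ((∑ b ∈ u, 3 ^ d * (box d (r b)).card : ℕ) : ℝ≥0∞) := by gcongr
    _ = 3 ^ d * ∑ b ∈ u, l * (box d (r b)).card := by
        push_cast
        rw [Finset.mul_sum, Finset.mul_sum]
        exact Finset.sum_congr rfl fun b _ => by ring
    _ ≤ 3 ^ d * ∑ b ∈ u, ∑ y ∈ B b, h y := by
        gcongr with b hb
        rw [hsumB]
        exact hl b (hut' hb)
    _ = 3 ^ d * ∑ y ∈ u.biUnion B, h y := by
        rw [Finset.sum_biUnion]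
        intro x hx y hy hxy
        exact Finset.disjoint_coe.1 (hdisj hx hy hxy)
    _ ≤ 3 ^ d * ∑ y ∈ W, h y := by
        gcongr
        intro y hy
        obtain ⟨b, hb, hyb⟩ := Finset.mem_biUnion.1 hy
        have := hW b (hut' hb) _ (hmemB.1 hyb)
        simpa using this

end Box

/-! ### The maximal inequality. -/

section Maximal

open scoped ENNReal

variable {d : ℕ} {Ω : Type*} [MeasurableSpace Ω] {μ : Measure Ω}
  {T : (Fin d → ℤ) → Ω → Ω}

/-- The weak type `(1, 1)` maximal inequality for averages over boxes under a measure preserving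
action of `ℤ^d`. -/
theorem mul_measure_exists_lt_sum_box_le [IsFiniteMeasure μ] (hT : IsStationary T μ)
    (hadd : ∀ x y ω, T (x + y) ω = T x (T y ω)) {h : Ω → ℝ≥0∞} (hh : Measurable h) (l : ℝ≥0∞) :
    l * μ {ω | ∃ n, l * (box d n).card < ∑ x ∈ box d n, h (T x ω)} ≤ 6 ^ d * ∫⁻ ω, h ω ∂μ := by
  classical
  set E : ℕ → Set Ω := fun N => ⋃ n ∈ Finset.range (N + 1),
    {ω | l * (box d n).card < ∑ x ∈ box d n, h (T x ω)} with hE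
  have hEmeas : ∀ N, MeasurableSet (E N) := fun N =>
    Finset.measurableSet_biUnion _ fun n _ => measurableSet_lt measurable_const
      (Finset.measurable_fun_sum _ fun x _ => hh.comp (hT x).measurable)
  have hEmono : Monotone E := fun M N hMN => Set.biUnion_subset_biUnion_left fun n hn => by
    simp only [Finset.coe_range, Set.mem_Iio, Finset.mem_range] at *
    exact lt_of_lt_of_le hn (by omega)
  have hEunion : {ω | ∃ n, l * (box d n).card < ∑ x ∈ box d n, h (T x ω)} = ⋃ N, E N := by
    ext ω
    simp only [hE, Set.mem_ofPred_eq, Set.mem_iUnion, Finset.mem_range]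
    exact ⟨fun ⟨n, hn⟩ => ⟨n, n, Nat.lt_succ_self n, hn⟩, fun ⟨_, n, _, hn⟩ => ⟨n, hn⟩⟩
  have hbound : ∀ N, l * μ (E N) ≤ 6 ^ d * ∫⁻ ω, h ω ∂μ := by
    intro N
    -- Transference: the covering inequality is applied along one orbit to the bad points of `box d
    -- N`. Radii are at most `N`, so all boxes stay in `box d (2 * N)`; this costs a factor `2 ^ d`
    -- after integration, whence `6 ^ d`.
    have hpt : ∀ ω, l * ∑ x ∈ box d N, (E N).indicator 1 (T x ω)
        ≤ 3 ^ d * ∑ y ∈ box d (2 * N), h (T y ω) := by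
      intro ω
      have hr : ∀ x, ∃ r : ℕ, T x ω ∈ E N →
          r ≤ N ∧ l * (box d r).card < ∑ y ∈ box d r, h (T (y + x) ω) := by
        intro x
        by_cases hx : T x ω ∈ E N
        · simp only [hE, Set.mem_iUnion, Finset.mem_range, Set.mem_ofPred_eq] at hx
          obtain ⟨n, hn, hn'⟩ := hx
          refine ⟨n, fun _ => ⟨by omega, ?_⟩⟩
          simpa only [hadd] using hn'
        · exact ⟨0, fun hx' => absurd hx' hx⟩
      choose r hr using hr
      have := mul_card_le_of_boxes ((box d N).filter fun x => T x ω ∈ E N) (box d (2 * N)) r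
        (fun y => h (T y ω)) l (fun x hx => (hr x (Finset.mem_filter.1 hx).2).2.le)
        (fun x hx y hy => by
          rw [Finset.mem_filter] at hx
          have := (hr x hx.2).1
          exact box_mono (by omega) (add_mem_box hy hx.1))
      convert this using 2
      simp [Set.indicator_apply]
    have hint := lintegral_mono (μ := μ) hpt
    have hm1 : ∀ x, Measurable fun ω => (E N).indicator (1 : Ω → ℝ≥0∞) (T x ω) := fun x =>
      (measurable_one.indicator (hEmeas N)).comp (hT x).measurable
    have hm2 : ∀ x, Measurable fun ω => h (T x ω) := fun x => hh.comp (hT x).measurable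
    rw [lintegral_const_mul _ (Finset.measurable_fun_sum _ fun x _ => hm1 x),
      lintegral_const_mul _ (Finset.measurable_fun_sum _ fun x _ => hm2 x),
      lintegral_finsetSum _ fun x _ => hm1 x, lintegral_finsetSum _ fun x _ => hm2 x] at hint
    have e1 : ∀ x, ∫⁻ ω, (E N).indicator (1 : Ω → ℝ≥0∞) (T x ω) ∂μ = μ (E N) := fun x => by
      rw [(hT x).lintegral_comp (measurable_one.indicator (hEmeas N)),
        lintegral_indicator_one (hEmeas N)]
    have e2 : ∀ x, ∫⁻ ω, h (T x ω) ∂μ = ∫⁻ ω, h ω ∂μ := fun x => (hT x).lintegral_comp hh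
    simp only [e1, e2, Finset.sum_const, nsmul_eq_mul] at hint
    have hc : ((box d (2 * N)).card : ℝ≥0∞) ≤ 2 ^ d * (box d N).card := by
      exact_mod_cast card_box_mul_le 2 N (by norm_num)
    have hne : ((box d N).card : ℝ≥0∞) ≠ 0 := by exact_mod_cast (card_box_pos N).ne'
    rw [← ENNReal.mul_le_mul_iff_right hne (ENNReal.natCast_ne_top _)]
    calc ((box d N).card : ℝ≥0∞) * (l * μ (E N)) = l * ((box d N).card * μ (E N)) := by ring
      _ ≤ 3 ^ d * ((box d (2 * N)).card * ∫⁻ ω, h ω ∂μ) := hint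
      _ ≤ 3 ^ d * (2 ^ d * (box d N).card * ∫⁻ ω, h ω ∂μ) := by gcongr
      _ = (box d N).card * ((3 * 2) ^ d * ∫⁻ ω, h ω ∂μ) := by rw [mul_pow]; ring
      _ = (box d N).card * (6 ^ d * ∫⁻ ω, h ω ∂μ) := by norm_num
  rw [hEunion, hEmono.measure_iUnion, ENNReal.mul_iSup]
  exact iSup_le hbound

end Maximal

/-! ### Mean and pointwise ergodic theorems. -/

section PointwiseErgodic

open scoped ENNReal

variable {d : ℕ} {Ω : Type*} [MeasurableSpace Ω] {μ : Measure Ω}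
  {T : (Fin d → ℤ) → Ω → Ω}

/-- The functions in `L²` with a version bounded by `C` that has asymptotically the same averages
over boxes as `f` along every orbit. -/
def sameAverages (T : (Fin d → ℤ) → Ω → Ω) (μ : Measure Ω) (f : Ω → ℝ) (C : ℝ) : Set (Lp ℝ 2 μ) :=
  {g | ∃ g₀ : Ω → ℝ, Measurable g₀ ∧ (∀ ω, |g₀ ω| ≤ C) ∧ g =ᵐ[μ] g₀ ∧
    ∀ ω, Tendsto (fun n => boxAvg n (fun x => g₀ (T x ω)) - boxAvg n fun x => f (T x ω))
      atTop (𝓝 0)}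

/-- Convexity gives the closure an element of minimal norm, the candidate for the limit of the
averages. -/
theorem convex_sameAverages (f : Ω → ℝ) (C : ℝ) : Convex ℝ (sameAverages T μ f C) := by
  rintro g ⟨g₀, hgm, hgC, hg, hgt⟩ h ⟨h₀, hhm, hhC, hh, hht⟩ a b ha hb hab
  refine ⟨fun ω => a * g₀ ω + b * h₀ ω, by fun_prop, fun ω => ?_, ?_, fun ω => ?_⟩
  · have h1 := abs_le.1 (hgC ω)
    have h2 := abs_le.1 (hhC ω)
    have hb' : b = 1 - a := by linarith
    subst hb'
    rw [abs_le]
    constructor <;> nlinarith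
  · filter_upwards [Lp.coeFn_add (a • g) (b • h), Lp.coeFn_smul a g, Lp.coeFn_smul b h, hg, hh]
      with ω h1 h2 h3 h4 h5
    rw [h1, Pi.add_apply, h2, h3, Pi.smul_apply, Pi.smul_apply, h4, h5, smul_eq_mul, smul_eq_mul]
  · have h1 := ((hgt ω).const_mul a).add ((hht ω).const_mul b)
    simp only [mul_zero, add_zero] at h1
    refine h1.congr fun n => ?_
    rw [boxAvg_add, boxAvg_const_mul, boxAvg_const_mul]
    have hb' : b = 1 - a := by linarith
    subst hb'
    ring

/-- Composing with `T w` translates the box over which one averages; the uniform bound `C` makes the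
change negligible on every orbit. -/
theorem comp_mem_sameAverages (hT : IsStationary T μ) (hadd : ∀ x y ω, T (x + y) ω = T x (T y ω))
    (f : Ω → ℝ) (C : ℝ) (w : Fin d → ℤ) {g : Lp ℝ 2 μ} (hg : g ∈ sameAverages T μ f C) :
    Lp.compMeasurePreserving (T w) (hT w) g ∈ sameAverages T μ f C := by
  obtain ⟨g₀, hgm, hgC, hg, hgt⟩ := hg
  refine ⟨fun ω => g₀ (T w ω), hgm.comp (hT w).measurable, fun ω => hgC _, ?_, fun ω => ?_⟩
  · exact (Lp.coeFn_compMeasurePreserving g (hT w)).trans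
      ((hT w).quasiMeasurePreserving.ae_eq_comp hg)
  · have h1 := (tendsto_boxAvg_shift_sub (a := fun x => g₀ (T x ω)) (fun x => hgC _) w).add (hgt ω)
    rw [add_zero] at h1
    refine h1.congr fun n => ?_
    simp only [← hadd, add_comm w]
    ring

/-- The mean ergodic theorem: some invariant function is an `L²`-limit of functions with the same
averages as `f`. -/
theorem exists_invariant_mem_closure (hT : IsStationary T μ) [IsFiniteMeasure μ]
    (hadd : ∀ x y ω, T (x + y) ω = T x (T y ω)) {f : Ω → ℝ} (hf : Measurable f) {C : ℝ}
    (hC : ∀ ω, |f ω| ≤ C) : ∃ v ∈ closure (sameAverages T μ f C),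
      ∀ w, Lp.compMeasurePreserving (T w) (hT w) v = v := by
  have hmem : MemLp f 2 μ := MemLp.of_bound hf.aestronglyMeasurable C (ae_of_all _ hC)
  have hne : (closure (sameAverages T μ f C)).Nonempty :=
    ⟨hmem.toLp f, subset_closure ⟨f, hf, hC, hmem.coeFn_toLp, fun ω => by simp⟩⟩
  have hconv := (convex_sameAverages (T := T) (μ := μ) f C).closure
  obtain ⟨v, hv, hmin⟩ := exists_norm_eq_iInf_of_complete_convex hne isClosed_closure.isComplete
    hconv 0
  refine ⟨v, hv, fun w => ?_⟩
  set Uv := Lp.compMeasurePreserving (T w) (hT w) v with hUv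
  have hU : Uv ∈ closure (sameAverages T μ f C) :=
    map_mem_closure (Lp.isometry_compMeasurePreserving (hT w)).continuous hv
      fun g hg => comp_mem_sameAverages hT hadd f C w hg
  -- The variational inequality at the minimizer gives `‖v‖² ≤ ⟪v, Uv⟫`. As `‖Uv‖ = ‖v‖`, expanding
  -- `‖Uv - v‖²` shows that it is at most 0.
  have h1 := (norm_eq_iInf_iff_real_inner_le_zero hconv hv).1 hmin Uv hU
  have h2 : ‖Uv‖ = ‖v‖ := Lp.norm_compMeasurePreserving v (hT w)
  have h3 := norm_sub_sq_real Uv v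
  rw [zero_sub, inner_neg_left, inner_sub_right, real_inner_self_eq_norm_sq,
    real_inner_comm] at h1
  rw [h2] at h3
  have h4 : ‖Uv - v‖ ^ 2 ≤ 0 := by linarith
  rw [← sub_eq_zero, ← norm_eq_zero]
  exact pow_eq_zero_iff two_ne_zero |>.1 (le_antisymm h4 (sq_nonneg _))

/-- Wiener's pointwise ergodic theorem for bounded functions: the averages over the boxes
`[-n, n]^d` along the orbits of a measure preserving action of `ℤ^d` converge almost surely. -/
theorem ae_exists_tendsto_boxAvg [IsProbabilityMeasure μ] (hT : IsStationary T μ)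
    (hadd : ∀ x y ω, T (x + y) ω = T x (T y ω)) {f : Ω → ℝ} (hf : Measurable f) {C : ℝ}
    (hC : ∀ ω, |f ω| ≤ C) :
    ∀ᵐ ω ∂μ, ∃ l, Tendsto (fun n => boxAvg n fun x => f (T x ω)) atTop (𝓝 l) := by
  obtain ⟨v, hv, hinv⟩ := exists_invariant_mem_closure hT hadd hf hC
  have hvm : Measurable v := (Lp.stronglyMeasurable v).measurable
  have hinv' : ∀ᵐ ω ∂μ, ∀ w, v (T w ω) = v ω := by
    refine ae_all_iff.2 fun w => ?_
    have := Lp.coeFn_compMeasurePreserving v (hT w)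
    rw [hinv w] at this
    exact this.symm
  have hnull : ∀ l : ℝ, 0 < l →
      ∀ᵐ ω ∂μ, ¬ ∃ᶠ n in atTop, 2 * l < |boxAvg n (fun x => f (T x ω)) - v ω| := by
    intro l hl
    have hle : ∀ ε : ℝ, 0 < ε → ENNReal.ofReal l *
        μ {ω | ∃ᶠ n in atTop, 2 * l < |boxAvg n (fun x => f (T x ω)) - v ω|}
          ≤ 6 ^ d * ENNReal.ofReal ε := by
      intro ε hε
      obtain ⟨g, ⟨g₀, hgm, -, hg, hgt⟩, hdist⟩ := Metric.mem_closure_iff.1 hv ε hε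
      have hmax := mul_measure_exists_lt_sum_box_le hT hadd
        (h := fun ω => ‖v ω - g₀ ω‖ₑ) (by fun_prop) (ENNReal.ofReal l)
      have hint : ∫⁻ ω, ‖v ω - g₀ ω‖ₑ ∂μ ≤ ENNReal.ofReal ε := by
        have e1 : ∫⁻ ω, ‖v ω - g₀ ω‖ₑ ∂μ = eLpNorm (v - g : Lp ℝ 2 μ) 1 μ := by
          rw [eLpNorm_one_eq_lintegral_enorm]
          refine lintegral_congr_ae ?_
          filter_upwards [hg, Lp.coeFn_sub v g] with ω h1 h2
          rw [h2, Pi.sub_apply, h1]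
        rw [e1]
        refine (eLpNorm_le_eLpNorm_of_exponent_le one_le_two
          (Lp.aestronglyMeasurable _)).trans ?_
        rw [← Lp.enorm_def, ← ofReal_norm, ← dist_eq_norm]
        exact ENNReal.ofReal_le_ofReal hdist.le
      refine le_trans ?_ (hmax.trans (by gcongr))
      refine mul_le_mul' le_rfl (measure_mono_ae ?_)
      -- The averages of `v` equal `v ω`, and those of `g₀` are eventually within `l` of those of
      -- `f`. A deviation above `2 * l` therefore makes the average of `|v - g₀|` exceed `l` for
      -- some `n`, which the maximal inequality controls.
      filter_upwards [hinv'] with ω hω hfreq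
      have hev : ∀ᶠ n in atTop,
          |boxAvg n (fun x => g₀ (T x ω)) - boxAvg n fun x => f (T x ω)| < l := by
        simpa using (hgt ω).abs.eventually_lt_const (by simpa using hl)
      obtain ⟨n, hn1, hn2⟩ := (hfreq.and_eventually hev).exists
      refine ⟨n, ?_⟩
      have h1 : l < boxAvg n fun x => |v (T x ω) - g₀ (T x ω)| := by
        refine lt_of_lt_of_le ?_ (abs_boxAvg_le n _)
        rw [boxAvg_sub]
        simp only [hω, boxAvg_const]
        rw [abs_lt] at hn2
        rw [lt_abs] at hn1 ⊢
        rcases hn1 with hn1 | hn1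
        · right; linarith [hn2.1]
        · left; linarith [hn2.2]
      rw [boxAvg, lt_div_iff₀ (by exact_mod_cast card_box_pos n)] at h1
      have h2 : ∑ x ∈ box d n, ‖v (T x ω) - g₀ (T x ω)‖ₑ
          = ENNReal.ofReal (∑ x ∈ box d n, |v (T x ω) - g₀ (T x ω)|) := by
        rw [ENNReal.ofReal_sum_of_nonneg fun _ _ => abs_nonneg _]
        simp only [← Real.norm_eq_abs, ofReal_norm]
      show ENNReal.ofReal l * _ < _
      rw [h2, ← ENNReal.ofReal_natCast, ← ENNReal.ofReal_mul hl.le]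
      exact (ENNReal.ofReal_lt_ofReal_iff_of_nonneg (by positivity)).2 h1
    have hzero : ENNReal.ofReal l *
        μ {ω | ∃ᶠ n in atTop, 2 * l < |boxAvg n (fun x => f (T x ω)) - v ω|} ≤ 0 := by
      have hlim : Tendsto (fun ε : ℝ => (6 : ℝ≥0∞) ^ d * ENNReal.ofReal ε) (𝓝[>] 0) (𝓝 0) := by
        have h0 : Tendsto (fun ε : ℝ => ENNReal.ofReal ε) (𝓝[>] 0) (𝓝 0) := by
          have := (ENNReal.continuous_ofReal.tendsto 0).mono_left (nhdsWithin_le_nhds (s := Set.Ioi 0))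
          simpa using this
        simpa using ENNReal.Tendsto.const_mul h0 (Or.inr (by finiteness))
      exact ge_of_tendsto hlim (by filter_upwards [self_mem_nhdsWithin] with ε hε using hle ε hε)
    rw [ae_iff]
    simp only [not_not]
    simpa [hl.not_ge] using hzero
  have hall : ∀ᵐ ω ∂μ, ∀ k : ℕ, ¬ ∃ᶠ n in atTop,
      2 * (1 / ((k : ℝ) + 1)) < |boxAvg n (fun x => f (T x ω)) - v ω| :=
    ae_all_iff.2 fun k => hnull _ (by positivity)
  filter_upwards [hall] with ω hω
  refine ⟨v ω, Metric.tendsto_atTop'.2 fun ε hε => ?_⟩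
  obtain ⟨k, hk⟩ := exists_nat_one_div_lt (half_pos hε)
  have h1 := hω k
  rw [not_frequently, eventually_atTop] at h1
  obtain ⟨N, hN⟩ := h1
  refine ⟨N, fun n hn => ?_⟩
  have := not_lt.1 (hN n (le_of_lt hn))
  rw [Real.dist_eq]
  linarith

end PointwiseErgodic

/-! ### Cylinder events of the coloring and cluster counts. -/

section Coloring

variable {V : Type*}

/-- The event that all vertices in `K` have color `1`. -/
def onesOn (K : Finset V) : Set (V → Fin 2) := {ω | ∀ v ∈ K, ω v = 1}

theorem measurableSet_onesOn (K : Finset V) : MeasurableSet (onesOn K) := by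
  have : onesOn K = ⋂ v ∈ K, (fun ω : V → Fin 2 => ω v) ⁻¹' {1} := by
    ext ω
    simp [onesOn]
  rw [this]
  exact Finset.measurableSet_biInter _ fun v _ =>
    measurable_pi_apply v (measurableSet_singleton _)

theorem onesOn_union [DecidableEq V] (K L : Finset V) :
    onesOn (K ∪ L) = onesOn K ∩ onesOn L := by
  ext ω
  simp only [onesOn, Finset.mem_union, Set.mem_ofPred_eq, Set.mem_inter_iff]
  exact ⟨fun h => ⟨fun v hv => h v (Or.inl hv), fun v hv => h v (Or.inr hv)⟩,
    fun h v hv => hv.elim (h.1 v) (h.2 v)⟩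

theorem onesOn_empty : onesOn (∅ : Finset V) = Set.univ := by
  ext ω
  simp [onesOn]

theorem isPiSystem_onesOn : IsPiSystem (Set.range (onesOn (V := V))) := by
  classical
  rintro _ ⟨K, rfl⟩ _ ⟨L, rfl⟩ -
  exact ⟨K ∪ L, onesOn_union K L⟩

/-- With two colors, the event of color 0 at a vertex is the complement of the event of color 1, so
events of all ones suffice. -/
theorem generateFrom_onesOn :
    MeasurableSpace.generateFrom (Set.range (onesOn (V := V))) = MeasurableSpace.pi := by
  refine le_antisymm (MeasurableSpace.generateFrom_le ?_) (iSup_le fun v => ?_)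
  · rintro _ ⟨K, rfl⟩
    exact measurableSet_onesOn K
  · rintro _ ⟨s, -, rfl⟩
    have h1 : MeasurableSet[MeasurableSpace.generateFrom (Set.range (onesOn (V := V)))]
        ((fun ω : V → Fin 2 => ω v) ⁻¹' {1}) :=
      MeasurableSpace.measurableSet_generateFrom ⟨{v}, by ext ω; simp [onesOn]⟩
    have h0 : (fun ω : V → Fin 2 => ω v) ⁻¹' {0} = ((fun ω : V → Fin 2 => ω v) ⁻¹' {1})ᶜ := by
      ext ω
      simp only [Set.mem_preimage, Set.mem_singleton_iff, Set.mem_compl_iff]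
      omega
    have h0' := h0 ▸ h1.compl
    have hs : (fun ω : V → Fin 2 => ω v) ⁻¹' s = ⋃ a ∈ s, (fun ω : V → Fin 2 => ω v) ⁻¹' {a} := by
      ext ω
      simp
    rw [hs]
    refine MeasurableSet.biUnion s.to_countable fun a _ => ?_
    fin_cases a
    · exact h0'
    · exact h1

open Classical in
/-- The number of clusters of `π` that meet `K`. -/
def clusterCount (π : Setoid V) (K : Finset V) : ℕ := (K.image (Quotient.mk π)).card

theorem measurable_comp_mk (π : Setoid V) :
    Measurable fun (c : Quotient π → Fin 2) v => c (Quotient.mk π v) :=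
  measurable_pi_lambda _ fun _ => measurable_pi_apply _

theorem clusterCount_le (π : Setoid V) (K : Finset V) : clusterCount π K ≤ K.card := by
  classical
  exact Finset.card_image_le

theorem clusterCount_union [DecidableEq V] {π : Setoid V} {K L : Finset V}
    (h : ∀ u ∈ K, ∀ v ∈ L, ¬ π u v) :
    clusterCount π (K ∪ L) = clusterCount π K + clusterCount π L := by
  classical
  unfold clusterCount
  have hd : Disjoint (K.image (Quotient.mk π)) (L.image (Quotient.mk π)) := by
    rw [Finset.disjoint_left]
    intro q hq hq'
    obtain ⟨u, hu, rfl⟩ := Finset.mem_image.1 hq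
    obtain ⟨v, hv, hvu⟩ := Finset.mem_image.1 hq'
    exact h u hu v hv (π.symm (Quotient.exact hvu))
  convert Finset.card_union_of_disjoint hd
  rw [← Finset.image_union]

instance isProbabilityMeasure_colorLaw (p : unitInterval) (π : Setoid V) :
    IsProbabilityMeasure (colorLaw p π) :=
  Measure.isProbabilityMeasure_map (measurable_comp_mk π).aemeasurable

theorem bernoulliMeasure_one_zero_singleton_one (p : unitInterval) :
    (bernoulliMeasure (1 : Fin 2) 0 p).real {1} = p := by
  classical
  rw [bernoulliMeasure_real_apply p (measurableSet_singleton _)]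
  simp

theorem bernoulliMeasure_one_zero_singleton_zero (p : unitInterval) :
    (bernoulliMeasure (1 : Fin 2) 0 p).real {0} = 1 - p := by
  classical
  rw [bernoulliMeasure_real_apply p (measurableSet_singleton _)]
  simp

/-- Each cluster meeting `K` contributes one independent factor `p`. -/
theorem colorLaw_onesOn (p : unitInterval) (π : Setoid V) (K : Finset V) :
    (colorLaw p π).real (onesOn K) = (p : ℝ) ^ clusterCount π K := by
  classical
  have h : (fun (c : Quotient π → Fin 2) v => c (Quotient.mk π v)) ⁻¹' onesOn K =
      Set.pi ((K.image (Quotient.mk π) : Finset _) : Set (Quotient π)) fun _ => {1} := by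
    ext c
    simp [onesOn, Set.mem_pi]
  rw [measureReal_def, colorLaw, Measure.map_apply (measurable_comp_mk π) (measurableSet_onesOn K), h,
    Measure.infinitePi_pi _ fun _ _ => measurableSet_singleton _, Finset.prod_const,
    ENNReal.toReal_pow, ← measureReal_def, bernoulliMeasure_one_zero_singleton_one]
  unfold clusterCount
  convert rfl

instance isMarkovKernel_colorKernel [Countable V] (p : unitInterval) :
    IsMarkovKernel (colorKernel V p) :=
  ⟨fun π => isProbabilityMeasure_colorLaw p π⟩

instance isProbabilityMeasure_jointLaw [Countable V] (p : unitInterval) (ν : Measure (Setoid V))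
    [IsProbabilityMeasure ν] : IsProbabilityMeasure (jointLaw p ν) := by
  unfold jointLaw
  infer_instance

theorem colorKernel_onesOn [Countable V] (p : unitInterval) (π : Setoid V) (K : Finset V) :
    (colorKernel V p π).real (onesOn K) = (p : ℝ) ^ clusterCount π K :=
  colorLaw_onesOn p π K

theorem measurable_pow_clusterCount [Countable V] (p : unitInterval) (K : Finset V) :
    Measurable fun π : Setoid V => (p : ℝ) ^ clusterCount π K := by
  simp_rw [← colorKernel_onesOn]
  exact ((colorKernel V p).measurable_coe (measurableSet_onesOn K)).ennreal_toReal

theorem jointLaw_prod_onesOn [Countable V] (p : unitInterval) (ν : Measure (Setoid V))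
    [IsProbabilityMeasure ν] {A : Set (Setoid V)} (hA : MeasurableSet A) (K : Finset V) :
    (jointLaw p ν).real (A ×ˢ onesOn K) = ∫ π in A, (p : ℝ) ^ clusterCount π K ∂ν := by
  rw [measureReal_def, jointLaw, Measure.compProd_apply_prod hA (measurableSet_onesOn K),
    ← integral_toReal]
  · exact integral_congr_ae (ae_of_all _ fun π => colorKernel_onesOn p π K)
  · exact ((colorKernel V p).measurable_coe (measurableSet_onesOn K)).aemeasurable
  · exact ae_of_all _ fun π => measure_lt_top _ _

end Coloring

/-! ### Translations and stationarity of the pair. -/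

section Shift

variable {d : ℕ}

theorem measurable_shiftColoring (x : Fin d → ℤ) : Measurable (shiftColoring x) :=
  measurable_pi_lambda _ fun y => measurable_pi_apply (y - x)

theorem shiftPartition_rel (x u v : Fin d → ℤ) (π : Setoid (Fin d → ℤ)) :
    shiftPartition x π u v ↔ π (u - x) (v - x) :=
  Iff.rfl

theorem shiftPartition_add (x y : Fin d → ℤ) (π : Setoid (Fin d → ℤ)) :
    shiftPartition (x + y) π = shiftPartition x (shiftPartition y π) := by
  refine Setoid.ext fun u v => ?_
  simp only [shiftPartition_rel, sub_add_eq_sub_sub]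

theorem shiftColoring_add (x y : Fin d → ℤ) (ω : (Fin d → ℤ) → Fin 2) :
    shiftColoring (x + y) ω = shiftColoring x (shiftColoring y ω) := by
  funext u
  simp only [shiftColoring, sub_add_eq_sub_sub]

theorem shiftJoint_add (x y : Fin d → ℤ) (ω : Setoid (Fin d → ℤ) × ((Fin d → ℤ) → Fin 2)) :
    shiftJoint (x + y) ω = shiftJoint x (shiftJoint y ω) := by
  simp [shiftJoint, Prod.map, shiftPartition_add, shiftColoring_add]

theorem preimage_shiftColoring_onesOn (x : Fin d → ℤ) (K : Finset (Fin d → ℤ)) :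
    shiftColoring x ⁻¹' onesOn K = onesOn (K.image (· - x)) := by
  ext ω
  simp [onesOn, shiftColoring]

theorem clusterCount_shiftPartition (x : Fin d → ℤ) (π : Setoid (Fin d → ℤ))
    (K : Finset (Fin d → ℤ)) :
    clusterCount (shiftPartition x π) K = clusterCount π (K.image (· - x)) := by
  classical
  unfold clusterCount
  -- The translation `y ↦ y - x` descends to an injection between the sets of clusters.
  let e : Quotient (shiftPartition x π) → Quotient π :=
    Quotient.lift (fun y => Quotient.mk π (y - x)) fun u v h => Quotient.sound h
  have he : Function.Injective e := by
    intro q q'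
    induction q, q' using Quotient.inductionOn₂ with
    | h u v => exact fun h => Quotient.sound (Quotient.exact h :)
  rw [← Finset.card_image_of_injective _ he, Finset.image_image, Finset.image_image]
  rfl

/-- Both sides agree on the π-system of events `onesOn K`. This equivariance is what makes the pair
stationary. -/
theorem colorLaw_shiftPartition (p : unitInterval) (x : Fin d → ℤ) (π : Setoid (Fin d → ℤ)) :
    colorLaw p (shiftPartition x π) = (colorLaw p π).map (shiftColoring x) := by
  have hm := measurable_shiftColoring x
  have : IsProbabilityMeasure ((colorLaw p π).map (shiftColoring x)) :=
    Measure.isProbabilityMeasure_map hm.aemeasurable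
  refine ext_of_generate_finite _ generateFrom_onesOn.symm isPiSystem_onesOn ?_ (by simp)
  rintro _ ⟨K, rfl⟩
  rw [Measure.map_apply hm (measurableSet_onesOn K), preimage_shiftColoring_onesOn,
    ← ENNReal.toReal_eq_toReal_iff' (measure_ne_top _ _) (measure_ne_top _ _), ← measureReal_def,
    ← measureReal_def, colorLaw_onesOn, colorLaw_onesOn, clusterCount_shiftPartition]

theorem isStationary_jointLaw (p : unitInterval) (ν : Measure (Setoid (Fin d → ℤ)))
    [IsProbabilityMeasure ν] (hν : IsStationary shiftPartition ν) :
    IsStationary shiftJoint (jointLaw p ν) := by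
  intro x
  have hm : Measurable (shiftJoint x) := (hν x).measurable.prodMap (measurable_shiftColoring x)
  refine ⟨hm, Measure.ext fun s hs => ?_⟩
  rw [Measure.map_apply hm hs, jointLaw, Measure.compProd_apply (hm hs),
    Measure.compProd_apply hs, ← (hν x).lintegral_comp (Kernel.measurable_kernel_prodMk_left hs)]
  refine lintegral_congr fun π => ?_
  have h1 : colorKernel (Fin d → ℤ) p (shiftPartition x π)
      = (colorKernel (Fin d → ℤ) p π).map (shiftColoring x) := colorLaw_shiftPartition p x π
  rw [h1, Measure.map_apply (measurable_shiftColoring x) (measurable_prodMk_left hs)]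
  rfl

end Shift

/-! ### Changing one coordinate of a product measure. -/

section Resampling

variable {ι X : Type*} [DecidableEq ι] [MeasurableSpace X]

theorem measurable_update_prod (i : ι) :
    Measurable fun z : X × (ι → X) => Function.update z.2 i z.1 := by
  refine measurable_pi_lambda _ fun j => ?_
  by_cases h : j = i
  · subst h
    simpa using measurable_fst
  · simp only [Function.update_of_ne h]
    fun_prop

/-- Resampling one coordinate preserves an infinite product measure. -/
theorem map_update_prod_infinitePi (b : Measure X) [IsProbabilityMeasure b] (i : ι) :
    (b.prod (Measure.infinitePi fun _ : ι => b)).map (fun z => Function.update z.2 i z.1)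
      = Measure.infinitePi fun _ : ι => b := by
  have hm := measurable_update_prod (X := X) i
  refine Measure.eq_infinitePi _ fun s t ht => ?_
  rw [Measure.map_apply hm (MeasurableSet.pi s.countable_toSet fun i _ => ht i)]
  have hpre : (fun z : X × (ι → X) => Function.update z.2 i z.1) ⁻¹' Set.pi (s : Set ι) t
      = (if i ∈ s then t i else Set.univ) ×ˢ Set.pi ((s.erase i : Finset ι) : Set ι) t := by
    ext z
    simp only [Set.mem_preimage, Set.mem_pi, Finset.mem_coe, Set.mem_prod, Finset.mem_erase]
    constructor
    · refine fun h => ⟨?_, fun j hj => ?_⟩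
      · split_ifs with hi
        · simpa using h i hi
        · trivial
      · simpa [hj.1] using h j hj.2
    · rintro ⟨h1, h2⟩ j hj
      by_cases hji : j = i
      · subst hji
        simpa [hj] using h1
      · simpa [hji] using h2 j ⟨hji, hj⟩
  rw [hpre, Measure.prod_prod, Measure.infinitePi_pi _ fun i _ => ht i]
  split_ifs with hi
  · exact Finset.mul_prod_erase s (fun j => b (t j)) hi
  · rw [measure_univ, one_mul, Finset.erase_eq_of_notMem hi]

/-- Resampling preserves the product measure, so by Fubini almost every fresh value is good; an atom
cannot be exceptional. -/
theorem ae_update_infinitePi {b : Measure X} [IsProbabilityMeasure b] {P : (ι → X) → Prop}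
    (h : ∀ᵐ c ∂Measure.infinitePi fun _ : ι => b, P c) (i : ι) {a : X} (ha : b {a} ≠ 0) :
    ∀ᵐ c ∂Measure.infinitePi fun _ : ι => b, P (Function.update c i a) := by
  rw [← map_update_prod_infinitePi b i] at h
  have hm := measurable_update_prod (X := X) i
  have h1 := Measure.ae_ae_of_ae_prod (ae_of_ae_map hm.aemeasurable h)
  by_contra hcon
  refine ha (measure_mono_null ?_ (ae_iff.1 h1))
  rintro _ rfl
  exact hcon

end Resampling

/-! ### Existence and vanishing of cluster densities. -/

section Density

variable {d : ℕ}

theorem boxAvg_indicator (n : ℕ) (S : Set (Fin d → ℤ)) :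
    boxAvg n (S.indicator fun _ => 1)
      = ((S ∩ (box d n : Set (Fin d → ℤ))).ncard : ℝ) / ((box d n).card : ℝ) := by
  classical
  have h : S ∩ (box d n : Set (Fin d → ℤ)) = ((box d n).filter (· ∈ S) : Finset _) := by
    ext x
    simp [and_comm]
  rw [boxAvg, h, Set.ncard_coe_finset]
  simp [Set.indicator_apply]

/-- Almost surely, the vertices of color `1` have a density. -/
theorem ae_exists_tendsto_boxAvg_color (p : unitInterval) (ν : Measure (Setoid (Fin d → ℤ)))
    [IsProbabilityMeasure ν] (hν : IsStationary shiftPartition ν) :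
    ∀ᵐ z ∂jointLaw p ν, ∃ l,
      Tendsto (fun n => boxAvg n fun x => ((z.2 x).val : ℝ)) atTop (𝓝 l) := by
  have h := ae_exists_tendsto_boxAvg (isStationary_jointLaw p ν hν) shiftJoint_add
    (f := fun z => ((z.2 0).val : ℝ)) (C := 1)
    ((measurable_of_finite (fun a : Fin 2 => (a.val : ℝ))).comp
      ((measurable_pi_apply 0).comp measurable_snd))
    (fun z => by
      rw [Nat.abs_cast]
      exact_mod_cast Nat.lt_succ_iff.1 (z.2 0).isLt)
  filter_upwards [h] with z hz
  obtain ⟨l, hl⟩ := hz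
  refine ⟨l, hl.congr fun n => ?_⟩
  -- The translate by `x` has at 0 the color of `-x`, and boxes are symmetric.
  rw [← boxAvg_neg]
  simp [shiftJoint, shiftColoring]

/-- Almost surely, every cluster has a density. -/
theorem ae_exists_hasDensity {p : unitInterval} (hp0 : 0 < p) (hp1 : p < 1)
    (ν : Measure (Setoid (Fin d → ℤ))) [IsProbabilityMeasure ν]
    (hν : IsStationary shiftPartition ν) :
    ∀ᵐ π ∂ν, ∀ v, ∃ α, HasDensity {y | π y v} α := by
  classical
  have h := Measure.ae_ae_of_ae_compProd (ae_exists_tendsto_boxAvg_color p ν hν)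
  filter_upwards [h] with π hπ v
  have h1 : ∀ᵐ ω ∂colorLaw p π, ∃ l,
      Tendsto (fun n => boxAvg n fun x => ((ω x).val : ℝ)) atTop (𝓝 l) := hπ
  have h2 := ae_of_ae_map (measurable_comp_mk π).aemeasurable h1
  have hb1 : bernoulliMeasure (1 : Fin 2) 0 p {1} ≠ 0 := by
    intro h0
    have := bernoulliMeasure_one_zero_singleton_one p
    rw [measureReal_def, h0] at this
    exact hp0.ne (Subtype.ext this)
  have hb0 : bernoulliMeasure (1 : Fin 2) 0 p {0} ≠ 0 := by
    intro h0
    have := bernoulliMeasure_one_zero_singleton_zero p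
    rw [measureReal_def, h0, ENNReal.toReal_zero] at this
    exact hp1.ne (Subtype.ext (by simpa using (sub_eq_zero.1 this.symm).symm))
  -- One coloring `c` whose two modifications, 1 and 0 on the cluster of `v`, both have a density of
  -- ones. They differ exactly by the indicator of this cluster.
  obtain ⟨c, ⟨l, hl⟩, m, hm⟩ :=
    ((ae_update_infinitePi h2 (Quotient.mk π v) hb1).and
      (ae_update_infinitePi h2 (Quotient.mk π v) hb0)).exists
  refine ⟨l - m, (hl.sub hm).congr fun n => ?_⟩
  rw [← boxAvg_indicator, ← boxAvg_sub]
  congr 1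
  funext y
  by_cases hy : π y v
  · have hq : Quotient.mk π y = Quotient.mk π v := Quotient.sound hy
    simp [hq, hy]
  · have hq : Quotient.mk π y ≠ Quotient.mk π v := fun hq => hy (Quotient.exact hq)
    simp [hq, hy]

/-- The density of the cluster of `v` exists almost surely, so `hdens` forces it to be 0;
proportions are bounded by 1, so their expectations converge too. -/
theorem tendsto_boxAvg_rel {p : unitInterval} (hp0 : 0 < p) (hp1 : p < 1)
    (ν : Measure (Setoid (Fin d → ℤ))) [IsProbabilityMeasure ν]
    (hν : IsStationary shiftPartition ν)
    (hdens : ν {π | ∃ φ ∈ π.classes, ∃ α : ℝ, 0 < α ∧ HasDensity φ α} = 0) (v : Fin d → ℤ) :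
    Tendsto (fun n => boxAvg n fun y => ν.real {π | π y v}) atTop (𝓝 0) := by
  have hzero : ∀ᵐ π ∂ν, Tendsto (fun n => boxAvg n fun y => {π' : Setoid _ | π' y v}.indicator
      (fun _ => (1 : ℝ)) π) atTop (𝓝 0) := by
    filter_upwards [ae_exists_hasDensity hp0 hp1 ν hν, measure_eq_zero_iff_ae_notMem.1 hdens]
      with π h1 h2
    obtain ⟨α, hα⟩ := h1 v
    have hα0 : 0 ≤ α := ge_of_tendsto' hα fun n => by positivity
    have : α = 0 := by
      by_contra hne
      exact h2 ⟨_, ⟨v, rfl⟩, α, lt_of_le_of_ne hα0 (Ne.symm hne), hα⟩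
    subst this
    refine hα.congr fun n => ?_
    rw [← boxAvg_indicator]
    rfl
  have hint : ∀ y, Integrable (fun π => {π' : Setoid (Fin d → ℤ) | π' y v}.indicator
      (fun _ => (1 : ℝ)) π) ν := fun y => (integrable_const _).indicator (measurableSet_rel y v)
  have h := tendsto_integral_of_dominated_convergence (μ := ν) (fun _ => (1 : ℝ))
    (fun n => (((integrable_finsetSum (box d n) fun y _ => hint y).div_const
      ((box d n).card : ℝ)).aestronglyMeasurable)) (integrable_const _)
    (fun n => ae_of_all _ fun π => by
      rw [Real.norm_eq_abs]
      refine (abs_boxAvg_le n _).trans ((boxAvg_mono (b := fun _ => 1) fun y => ?_).trans_eq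
        (boxAvg_const n 1))
      by_cases hy : π y v <;> simp [hy]) hzero
  rw [integral_zero] at h
  refine h.congr fun n => ?_
  rw [integral_div, integral_finsetSum _ fun y _ => hint y]
  simp only [integral_indicator_const _ (measurableSet_rel _ _), smul_eq_mul, mul_one]
  rfl

end Density

/-! ### Weak mixing: reduction to a π-system, and factors. -/

section WeakMixing

variable {d : ℕ} {Ω : Type*} [mΩ : MeasurableSpace Ω]

theorem tendsto_boxAvg_zero_of_forall_pos {a : (Fin d → ℤ) → ℝ} (ha : ∀ x, 0 ≤ a x)
    (h : ∀ ε > 0, ∃ b : (Fin d → ℤ) → ℝ, Tendsto (fun n => boxAvg n b) atTop (𝓝 0) ∧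
      ∀ x, a x ≤ b x + ε) : Tendsto (fun n => boxAvg n a) atTop (𝓝 0) := by
  refine Metric.tendsto_atTop'.2 fun ε hε => ?_
  obtain ⟨b, hb, hab⟩ := h (ε / 2) (half_pos hε)
  obtain ⟨N, hN⟩ := eventually_atTop.1 (hb.eventually_lt_const (half_pos hε))
  refine ⟨N, fun n hn => ?_⟩
  rw [Real.dist_eq, sub_zero, abs_of_nonneg (boxAvg_nonneg ha)]
  have h1 := boxAvg_mono (n := n) hab
  rw [boxAvg_add, boxAvg_const] at h1
  linarith [hN n hn.le]

/-- Asymptotic proportionality to `μ`, in absolute Cesàro mean, of a family of measures dominated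
by `μ` can be checked on a generating π-system. -/
theorem tendsto_boxAvg_abs_sub_of_isPiSystem {μ : Measure Ω} [IsProbabilityMeasure μ]
    (m : (Fin d → ℤ) → Measure Ω) (hle : ∀ x, m x ≤ μ) {c : ℝ}
    (hc : ∀ x, (m x).real Set.univ = c) {𝒞 : Set (Set Ω)}
    (hgen : mΩ = MeasurableSpace.generateFrom 𝒞) (hpi : IsPiSystem 𝒞)
    (h : ∀ S ∈ 𝒞, Tendsto (fun n => boxAvg n fun x => |(m x).real S - μ.real S * c|) atTop (𝓝 0))
    {S : Set Ω} (hS : MeasurableSet S) :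
    Tendsto (fun n => boxAvg n fun x => |(m x).real S - μ.real S * c|) atTop (𝓝 0) := by
  have hfin : ∀ x, IsFiniteMeasure (m x) := fun x => isFiniteMeasure_of_le μ (hle x)
  have hle' : ∀ x S, (m x).real S ≤ μ.real S := fun x S =>
    ENNReal.toReal_mono (measure_ne_top _ _) (hle x S)
  have hc0 : 0 ≤ c := hc 0 ▸ measureReal_nonneg
  have hc1 : c ≤ 1 := by
    rw [← hc 0]
    exact (hle' 0 _).trans measureReal_le_one
  refine MeasurableSpace.induction_on_inter (C := fun S _ => Tendsto (fun n => boxAvg n fun x =>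
    |(m x).real S - μ.real S * c|) atTop (𝓝 0)) hgen hpi ?_ h ?_ ?_ S hS
  · simp [boxAvg_const]
  · intro t ht hlim
    refine hlim.congr fun n => ?_
    congr 1
    funext x
    rw [measureReal_compl ht, measureReal_compl ht, hc, probReal_univ, ← abs_neg]
    congr 1
    ring
  · intro f hdisj hf hlim
    refine tendsto_boxAvg_zero_of_forall_pos (fun _ => abs_nonneg _) fun ε hε => ?_
    have hsum : HasSum (fun i => μ.real (f i)) (μ.real (⋃ i, f i)) := by
      have hne : ∑' i, μ (f i) ≠ ⊤ := by
        rw [← measure_iUnion hdisj hf]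
        exact measure_ne_top _ _
      rw [measureReal_def, measure_iUnion hdisj hf,
        ENNReal.tsum_toReal_eq fun i => measure_ne_top _ _]
      exact (ENNReal.summable_toReal hne).hasSum
    -- The tail of the union has `μ`-measure at most `ε`. By `m x ≤ μ` and `0 ≤ c ≤ 1`, its
    -- contribution is at most `ε` uniformly in `x`.
    obtain ⟨N, hN⟩ := ((tendsto_order.1 hsum.tendsto_sum_nat).1 _ (sub_lt_self _ hε)).exists
    refine ⟨fun x => ∑ i ∈ Finset.range N, |(m x).real (f i) - μ.real (f i) * c|, ?_, fun x => ?_⟩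
    · simp only [boxAvg_sum]
      simpa using tendsto_finsetSum (Finset.range N) fun i _ => hlim i
    · set U := ⋃ i, f i with hU
      set W := ⋃ i ∈ Finset.range N, f i with hW
      have hWm : MeasurableSet W := Finset.measurableSet_biUnion _ fun i _ => hf i
      have hWU : W ⊆ U := Set.iUnion₂_subset fun i _ => Set.subset_iUnion f i
      have hd : Set.PairwiseDisjoint (Finset.range N : Set ℕ) f := fun i _ j _ hij => hdisj hij
      have e1 : μ.real W = ∑ i ∈ Finset.range N, μ.real (f i) :=
        measureReal_biUnion_finset hd fun i _ => hf i
      have e2 : (m x).real W = ∑ i ∈ Finset.range N, (m x).real (f i) :=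
        measureReal_biUnion_finset hd fun i _ => hf i
      have e3 : |(m x).real W - μ.real W * c|
          ≤ ∑ i ∈ Finset.range N, |(m x).real (f i) - μ.real (f i) * c| := by
        rw [e1, e2, Finset.sum_mul, ← Finset.sum_sub_distrib]
        exact Finset.abs_sum_le_sum_abs _ _
      have e4 : (m x).real (U \ W) = (m x).real U - (m x).real W := measureReal_sdiff hWU hWm
      have e5 : μ.real (U \ W) = μ.real U - μ.real W := measureReal_sdiff hWU hWm
      have e6 := hle' x (U \ W)
      have e7 : 0 ≤ (m x).real (U \ W) := measureReal_nonneg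
      have e8 : 0 ≤ μ.real (U \ W) := measureReal_nonneg
      have e9 : μ.real (U \ W) ≤ ε := by
        rw [e5, e1]
        linarith
      refine le_trans ?_ (add_le_add_left e3 ε)
      have e10 : μ.real (U \ W) * c ≤ μ.real (U \ W) := mul_le_of_le_one_right e8 hc1
      have e11 : 0 ≤ μ.real (U \ W) * c := mul_nonneg e8 hc0
      have e12 : (m x).real U - μ.real U * c = ((m x).real W - μ.real W * c)
          + ((m x).real (U \ W) - μ.real (U \ W) * c) := by
        rw [e4, e5]
        ring
      rw [e12]
      refine (abs_add_le _ _).trans (add_le_add_right ?_ _)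
      rw [abs_le]
      constructor <;> linarith

/-- Weak mixing can be checked on a generating π-system. -/
theorem IsWeaklyMixing.of_isPiSystem {T : (Fin d → ℤ) → Ω → Ω} {μ : Measure Ω}
    [IsProbabilityMeasure μ] (hT : IsStationary T μ) {𝒞 : Set (Set Ω)}
    (hgen : mΩ = MeasurableSpace.generateFrom 𝒞) (hpi : IsPiSystem 𝒞)
    (h : ∀ A ∈ 𝒞, ∀ B ∈ 𝒞, Tendsto (fun n => boxAvg n fun x =>
      |μ.real (A ∩ T x ⁻¹' B) - μ.real A * μ.real B|) atTop (𝓝 0)) :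
    IsWeaklyMixing T μ := by
  have hmeas : ∀ S ∈ 𝒞, MeasurableSet S := fun S hS => by
    rw [hgen]
    exact MeasurableSpace.measurableSet_generateFrom hS
  have h1 : ∀ A, MeasurableSet A → ∀ B ∈ 𝒞, Tendsto (fun n => boxAvg n fun x =>
      |μ.real (A ∩ T x ⁻¹' B) - μ.real A * μ.real B|) atTop (𝓝 0) := by
    intro A hA B hB
    -- First extension: `B` is fixed in the π-system and `A` varies.
    have key := tendsto_boxAvg_abs_sub_of_isPiSystem (μ := μ) (c := μ.real B)
      (fun x => μ.restrict (T x ⁻¹' B)) (fun x => Measure.restrict_le_self)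
      (fun x => by
        rw [measureReal_restrict_apply_univ]
        exact (hT x).measureReal_preimage (hmeas B hB).nullMeasurableSet) hgen hpi
      (fun S hS => by simpa only [measureReal_restrict_apply (hmeas S hS)] using h S hS B hB) hA
    simpa only [measureReal_restrict_apply hA] using key
  refine ⟨hT, fun A B hA hB => ?_⟩
  have hmap : ∀ x S, MeasurableSet S →
      ((μ.restrict A).map (T x)).real S = μ.real (A ∩ T x ⁻¹' S) := fun x S hS => by
    rw [map_measureReal_apply (hT x).measurable hS,
      measureReal_restrict_apply ((hT x).measurable hS), Set.inter_comm]
  -- Second extension: `A` is now arbitrary and `B` varies. Invariance of `μ` gives the required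
  -- domination by `μ`.
  have key := tendsto_boxAvg_abs_sub_of_isPiSystem (μ := μ) (c := μ.real A)
    (fun x => (μ.restrict A).map (T x))
    (fun x => (Measure.map_mono Measure.restrict_le_self (hT x).measurable).trans_eq (hT x).map_eq)
    (fun x => by simp [hmap]) hgen hpi
    (fun S hS => by simpa only [hmap _ S (hmeas S hS), mul_comm (μ.real S)] using h1 A hA S hS) hB
  simpa only [hmap _ B hB, mul_comm (μ.real B), boxAvg] using key

/-- A factor of a weakly mixing system is weakly mixing. -/
theorem IsWeaklyMixing.map {Ω' : Type*} [MeasurableSpace Ω'] {T : (Fin d → ℤ) → Ω → Ω}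
    {T' : (Fin d → ℤ) → Ω' → Ω'} {μ : Measure Ω} (h : IsWeaklyMixing T μ) {q : Ω → Ω'}
    (hq : Measurable q) (hT' : ∀ x, Measurable (T' x)) (hqT : ∀ x ω, q (T x ω) = T' x (q ω)) :
    IsWeaklyMixing T' (μ.map q) := by
  have hcomp : ∀ x, T' x ∘ q = q ∘ T x := fun x => funext fun ω => (hqT x ω).symm
  refine ⟨fun x => ⟨hT' x, ?_⟩, fun A B hA hB => ?_⟩
  · rw [Measure.map_map (hT' x) hq, hcomp, ← Measure.map_map hq (h.stationary x).measurable,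
      (h.stationary x).map_eq]
  · refine (h.tendsto_zero _ _ (hq hA) (hq hB)).congr fun n => ?_
    congr 1
    refine Finset.sum_congr rfl fun x _ => ?_
    rw [map_measureReal_apply hq hA, map_measureReal_apply hq hB,
      map_measureReal_apply hq (hA.inter (hT' x hB)), Set.preimage_inter, ← Set.preimage_comp,
      ← Set.preimage_comp, hcomp]

/-- This turns integrals of powers of `p` into finite combinations of measures of events, to which
mixing applies. -/
theorem setIntegral_comp_eq_sum {ι : Type*} {μ : Measure Ω} [IsFiniteMeasure μ]
    (s : Finset ι) {g : Ω → ι} (hg : ∀ ω, g ω ∈ s) (hgm : ∀ i, MeasurableSet (g ⁻¹' {i}))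
    (φ : ι → ℝ) (S : Set Ω) :
    ∫ ω in S, φ (g ω) ∂μ = ∑ i ∈ s, φ i * μ.real (S ∩ g ⁻¹' {i}) := by
  have h1 : ∀ ω, φ (g ω) = ∑ i ∈ s, (g ⁻¹' {i}).indicator (fun _ => φ i) ω := fun ω => by
    rw [Finset.sum_eq_single_of_mem (g ω) (hg ω), Set.indicator_of_mem]
    · rfl
    · intro i _ hi
      have h : ω ∉ g ⁻¹' {i} := fun h => hi (Set.mem_singleton_iff.1 h).symm
      exact Set.indicator_of_notMem h _
  rw [integral_congr_ae (ae_of_all _ h1), integral_finsetSum _ fun i _ => (integrable_const _).indicator (hgm i)]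
  refine Finset.sum_congr rfl fun i _ => ?_
  rw [integral_indicator_const _ (hgm i), measureReal_restrict_apply (hgm i), smul_eq_mul,
    mul_comm, Set.inter_comm]

end WeakMixing

/-! ### Weak mixing of the pair. -/

section Joint

variable {d : ℕ}

theorem measurableSet_clusterCount {V : Type*} [Countable V] (K : Finset V) (k : ℕ) :
    MeasurableSet ((fun π : Setoid V => clusterCount π K) ⁻¹' {k}) := by
  -- At parameter `1 / 2` the power is measurable and determines the count, because `k ↦ (1 / 2) ^
  -- k` is injective.
  set q : unitInterval := ⟨1 / 2, by norm_num, by norm_num⟩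
  have h := measurable_pow_clusterCount q K (measurableSet_singleton ((q : ℝ) ^ k))
  convert h using 1
  ext π
  simp only [Set.mem_preimage, Set.mem_singleton_iff]
  exact (pow_right_injective₀ (show (0 : ℝ) < 1 / 2 by norm_num) (by norm_num)).eq_iff.symm

theorem tendsto_boxAvg_rel_sub {p : unitInterval} (hp0 : 0 < p) (hp1 : p < 1)
    (ν : Measure (Setoid (Fin d → ℤ))) [IsProbabilityMeasure ν]
    (hν : IsStationary shiftPartition ν)
    (hdens : ν {π | ∃ φ ∈ π.classes, ∃ α : ℝ, 0 < α ∧ HasDensity φ α} = 0) (u v : Fin d → ℤ) :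
    Tendsto (fun n => boxAvg n fun x => ν.real {π | π u (v - x)}) atTop (𝓝 0) := by
  have h := (tendsto_boxAvg_shift_sub (a := fun y => ν.real {π | π y u}) (C := 1) (fun y => by
    rw [abs_of_nonneg measureReal_nonneg]
    exact measureReal_le_one) v).add (tendsto_boxAvg_rel hp0 hp1 ν hν hdens u)
  simp only [sub_add_cancel, add_zero] at h
  refine h.congr fun n => ?_
  rw [← boxAvg_neg]
  congr 1
  funext x
  congr 1
  ext π
  simp only [Set.mem_ofPred_eq, neg_add_eq_sub]
  exact ⟨fun h => π.symm h, fun h => π.symm h⟩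

/-- If no cluster has positive density, then up to an asymptotically negligible error the colors
of `K` and of a translate of `L` are conditionally independent given the partition. -/
theorem abs_jointLaw_sub_le (p : unitInterval) (ν : Measure (Setoid (Fin d → ℤ)))
    [IsProbabilityMeasure ν] (hν : IsStationary shiftPartition ν) {A B : Set (Setoid (Fin d → ℤ))}
    (hA : MeasurableSet A) (hB : MeasurableSet B) (K L : Finset (Fin d → ℤ)) (x : Fin d → ℤ) :
    |(jointLaw p ν).real (A ×ˢ onesOn K ∩ shiftJoint x ⁻¹' (B ×ˢ onesOn L))
      - ∫ π in A ∩ shiftPartition x ⁻¹' B,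
        (p : ℝ) ^ (clusterCount π K + clusterCount (shiftPartition x π) L) ∂ν|
      ≤ ∑ u ∈ K, ∑ v ∈ L, ν.real {π | π u (v - x)} := by
  classical
  have hAB : MeasurableSet (A ∩ shiftPartition x ⁻¹' B) := hA.inter ((hν x).measurable hB)
  have hp0 : (0 : ℝ) ≤ p := p.2.1
  have hp1 : (p : ℝ) ≤ 1 := p.2.2
  have hset : A ×ˢ onesOn K ∩ shiftJoint x ⁻¹' (B ×ˢ onesOn L)
      = (A ∩ shiftPartition x ⁻¹' B) ×ˢ onesOn (K ∪ L.image (· - x)) := by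
    rw [onesOn_union, ← preimage_shiftColoring_onesOn, Set.prod_inter_prod.symm]
    rfl
  have hm1 : Measurable fun π : Setoid (Fin d → ℤ) =>
      (p : ℝ) ^ clusterCount π (K ∪ L.image (· - x)) := measurable_pow_clusterCount p _
  have hm2 : Measurable fun π : Setoid (Fin d → ℤ) =>
      (p : ℝ) ^ (clusterCount π K + clusterCount (shiftPartition x π) L) := by
    simp_rw [pow_add]
    exact (measurable_pow_clusterCount p K).mul
      ((measurable_pow_clusterCount p L).comp (hν x).measurable)
  have hb : ∀ k : ℕ, ‖(p : ℝ) ^ k‖ ≤ 1 := fun k => by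
    rw [Real.norm_of_nonneg (by positivity)]
    exact pow_le_one₀ hp0 hp1
  have hi1 := Integrable.of_bound (μ := ν.restrict (A ∩ shiftPartition x ⁻¹' B))
    hm1.aestronglyMeasurable 1 (ae_of_all _ fun π => hb _)
  have hi2 := Integrable.of_bound (μ := ν.restrict (A ∩ shiftPartition x ⁻¹' B))
    hm2.aestronglyMeasurable 1 (ae_of_all _ fun π => hb _)
  have hind : ∀ u v : Fin d → ℤ, Integrable (fun π =>
      {π' : Setoid (Fin d → ℤ) | π' u (v - x)}.indicator (fun _ => (1 : ℝ)) π) ν := fun u v =>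
    (integrable_const _).indicator (measurableSet_rel u (v - x))
  have hi3 : Integrable (fun π => ∑ u ∈ K, ∑ v ∈ L,
      {π' : Setoid (Fin d → ℤ) | π' u (v - x)}.indicator (fun _ => (1 : ℝ)) π) ν :=
    integrable_finsetSum _ fun u _ => integrable_finsetSum _ fun v _ => hind u v
  have hnn : ∀ (π : Setoid (Fin d → ℤ)) (u v : Fin d → ℤ), (0 : ℝ) ≤
      {π' : Setoid (Fin d → ℤ) | π' u (v - x)}.indicator (fun _ => (1 : ℝ)) π := fun π u v =>
    Set.indicator_nonneg (fun _ _ => zero_le_one) _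
  -- Both powers lie in `[0, 1]`, and they coincide unless some cluster meets both `K` and `L - x`,
  -- in which case the right side is at least 1.
  have hpt : ∀ π : Setoid (Fin d → ℤ), ‖(p : ℝ) ^ clusterCount π (K ∪ L.image (· - x))
      - (p : ℝ) ^ (clusterCount π K + clusterCount (shiftPartition x π) L)‖
      ≤ ∑ u ∈ K, ∑ v ∈ L,
        {π' : Setoid (Fin d → ℤ) | π' u (v - x)}.indicator (fun _ => (1 : ℝ)) π := by
    intro π
    by_cases hrel : ∃ u ∈ K, ∃ v ∈ L, π u (v - x)
    · obtain ⟨u, hu, v, hv, huv⟩ := hrel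
      have h1 : (1 : ℝ) ≤ ∑ u ∈ K, ∑ v ∈ L,
          {π' : Setoid (Fin d → ℤ) | π' u (v - x)}.indicator (fun _ => (1 : ℝ)) π := by
        refine le_trans ?_ (Finset.single_le_sum (fun u _ => Finset.sum_nonneg fun v _ =>
          hnn π u v) hu)
        refine le_trans ?_ (Finset.single_le_sum (fun v _ => hnn π u v) hv)
        simp [huv]
      refine le_trans ?_ h1
      have h2 := pow_le_one₀ hp0 hp1 (n := clusterCount π (K ∪ L.image (· - x)))
      have h3 := pow_le_one₀ hp0 hp1
        (n := clusterCount π K + clusterCount (shiftPartition x π) L)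
      have h4 := pow_nonneg hp0 (clusterCount π (K ∪ L.image (· - x)))
      have h5 := pow_nonneg hp0 (clusterCount π K + clusterCount (shiftPartition x π) L)
      rw [Real.norm_eq_abs, abs_le]
      constructor <;> linarith
    · push Not at hrel
      have h1 : clusterCount π (K ∪ L.image (· - x))
          = clusterCount π K + clusterCount (shiftPartition x π) L := by
        rw [clusterCount_shiftPartition]
        refine clusterCount_union fun u hu v hv => ?_
        obtain ⟨w, hw, rfl⟩ := Finset.mem_image.1 hv
        exact hrel u hu w hw
      rw [h1, sub_self, norm_zero]
      exact Finset.sum_nonneg fun u _ => Finset.sum_nonneg fun v _ => hnn π u v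
  rw [hset, jointLaw_prod_onesOn p ν hAB, ← integral_sub hi1 hi2, ← Real.norm_eq_abs]
  calc ‖∫ π in A ∩ shiftPartition x ⁻¹' B, _ ∂ν‖
      ≤ ∫ π in A ∩ shiftPartition x ⁻¹' B, ∑ u ∈ K, ∑ v ∈ L,
        {π' : Setoid (Fin d → ℤ) | π' u (v - x)}.indicator (fun _ => (1 : ℝ)) π ∂ν :=
        norm_integral_le_of_norm_le hi3.restrict (ae_of_all _ hpt)
    _ ≤ ∫ π, ∑ u ∈ K, ∑ v ∈ L,
        {π' : Setoid (Fin d → ℤ) | π' u (v - x)}.indicator (fun _ => (1 : ℝ)) π ∂ν :=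
        setIntegral_le_integral hi3 (ae_of_all _ fun π =>
          Finset.sum_nonneg fun u _ => Finset.sum_nonneg fun v _ => hnn π u v)
    _ = ∑ u ∈ K, ∑ v ∈ L, ν.real {π | π u (v - x)} := by
        rw [integral_finsetSum _ fun u _ => integrable_finsetSum _ fun v _ => hind u v]
        refine Finset.sum_congr rfl fun u _ => ?_
        rw [integral_finsetSum _ fun v _ => hind u v]
        refine Finset.sum_congr rfl fun v _ => ?_
        rw [integral_indicator_const _ (measurableSet_rel _ _), smul_eq_mul, mul_one]

/-- If no cluster has positive density and the partition is weakly mixing, then so is the pair of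
the partition and its coloring. -/
theorem isWeaklyMixing_jointLaw {p : unitInterval} (hp0 : 0 < p) (hp1 : p < 1)
    (ν : Measure (Setoid (Fin d → ℤ))) [IsProbabilityMeasure ν]
    (hdens : ν {π | ∃ φ ∈ π.classes, ∃ α : ℝ, 0 < α ∧ HasDensity φ α} = 0)
    (hmix : IsWeaklyMixing shiftPartition ν) :
    IsWeaklyMixing shiftJoint (jointLaw p ν) := by
  have hν := hmix.stationary
  refine IsWeaklyMixing.of_isPiSystem (isStationary_jointLaw p ν hν)
    (generateFrom_eq_prod MeasurableSpace.generateFrom_measurableSet generateFrom_onesOn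
      isCountablySpanning_measurableSet
      ⟨fun _ => Set.univ, fun _ => ⟨∅, onesOn_empty⟩, Set.iUnion_const _⟩).symm
    (MeasurableSpace.isPiSystem_measurableSet.prod isPiSystem_onesOn) ?_
  rintro _ ⟨A, hA, _, ⟨K, rfl⟩, rfl⟩ _ ⟨B, hB, _, ⟨L, rfl⟩, rfl⟩
  rw [Set.mem_ofPred_eq] at hA hB
  set s := Finset.range (K.card + 1) ×ˢ Finset.range (L.card + 1) with hs
  -- Splitting `A` and `B` by cluster count makes the powers of `p` constant on each piece.
  set Ak : ℕ → Set (Setoid (Fin d → ℤ)) := fun k => A ∩ (fun π => clusterCount π K) ⁻¹' {k}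
  set Bl : ℕ → Set (Setoid (Fin d → ℤ)) := fun l => B ∩ (fun π => clusterCount π L) ⁻¹' {l}
  have hAk : ∀ k, MeasurableSet (Ak k) := fun k => hA.inter (measurableSet_clusterCount K k)
  have hBl : ∀ l, MeasurableSet (Bl l) := fun l => hB.inter (measurableSet_clusterCount L l)
  have hmem : ∀ (π : Setoid (Fin d → ℤ)) (K : Finset (Fin d → ℤ)),
      clusterCount π K ∈ Finset.range (K.card + 1) := fun π K =>
    Finset.mem_range.2 (Nat.lt_succ_of_le (clusterCount_le π K))
  have hone : ∀ {A : Set (Setoid (Fin d → ℤ))} (hA : MeasurableSet A) (K : Finset (Fin d → ℤ)),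
      (jointLaw p ν).real (A ×ˢ onesOn K) = ∑ k ∈ Finset.range (K.card + 1),
        (p : ℝ) ^ k * ν.real (A ∩ (fun π => clusterCount π K) ⁻¹' {k}) := fun hA K => by
    rw [jointLaw_prod_onesOn p ν hA]
    exact setIntegral_comp_eq_sum _ (fun π => hmem π K) (measurableSet_clusterCount K)
      (fun k => (p : ℝ) ^ k) _
  have htwo : ∀ x, ∫ π in A ∩ shiftPartition x ⁻¹' B,
      (p : ℝ) ^ (clusterCount π K + clusterCount (shiftPartition x π) L) ∂ν
      = ∑ i ∈ s, (p : ℝ) ^ (i.1 + i.2) * ν.real (Ak i.1 ∩ shiftPartition x ⁻¹' Bl i.2) := by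
    intro x
    have hpre : ∀ i : ℕ × ℕ, (fun π : Setoid (Fin d → ℤ) =>
        (clusterCount π K, clusterCount (shiftPartition x π) L)) ⁻¹' {i}
        = (fun π => clusterCount π K) ⁻¹' {i.1} ∩
          shiftPartition x ⁻¹' ((fun π => clusterCount π L) ⁻¹' {i.2}) := fun i => by
      ext π
      simp [Prod.ext_iff]
    rw [setIntegral_comp_eq_sum s
      (g := fun π => (clusterCount π K, clusterCount (shiftPartition x π) L))
      (fun π => Finset.mk_mem_product (hmem _ K) (hmem _ L)) (fun i => by
        rw [hpre]
        exact (measurableSet_clusterCount K _).inter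
          ((hν x).measurable (measurableSet_clusterCount L _)))
      (fun i => (p : ℝ) ^ (i.1 + i.2)) _]
    refine Finset.sum_congr rfl fun i _ => ?_
    rw [hpre, Set.inter_inter_inter_comm]
    rfl
  refine tendsto_boxAvg_zero_of_le (b := fun x => (∑ u ∈ K, ∑ v ∈ L, ν.real {π | π u (v - x)})
    + ∑ i ∈ s, (p : ℝ) ^ (i.1 + i.2) *
      |ν.real (Ak i.1 ∩ shiftPartition x ⁻¹' Bl i.2) - ν.real (Ak i.1) * ν.real (Bl i.2)|)
    (fun _ => abs_nonneg _) (fun x => ?_) ?_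
  · have h1 := abs_jointLaw_sub_le p ν hν hA hB K L x
    rw [htwo] at h1
    refine (abs_sub_le _ _ _).trans (add_le_add h1 ?_)
    rw [hone hA, hone hB, Finset.sum_mul_sum, ← Finset.sum_product', ← Finset.sum_sub_distrib]
    refine (Finset.abs_sum_le_sum_abs _ _).trans (Finset.sum_le_sum fun i _ => ?_)
    rw [← abs_of_nonneg (pow_nonneg p.2.1 (i.1 + i.2)), ← abs_mul,
      abs_of_nonneg (pow_nonneg p.2.1 (i.1 + i.2))]
    refine le_of_eq ?_
    congr 1
    simp only [Ak, Bl]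
    ring
  · simp only [boxAvg_add, boxAvg_sum, boxAvg_const_mul]
    have h1 : Tendsto (fun n => ∑ u ∈ K, ∑ v ∈ L, boxAvg n fun x => ν.real {π | π u (v - x)})
        atTop (𝓝 0) := by
      simpa using tendsto_finsetSum K fun u _ => tendsto_finsetSum L fun v _ =>
        tendsto_boxAvg_rel_sub hp0 hp1 ν hν hdens u v
    have h2 : Tendsto (fun n => ∑ i ∈ s, (p : ℝ) ^ (i.1 + i.2) * boxAvg n fun x =>
        |ν.real (Ak i.1 ∩ shiftPartition x ⁻¹' Bl i.2) - ν.real (Ak i.1) * ν.real (Bl i.2)|)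
        atTop (𝓝 0) := by
      have := tendsto_finsetSum s fun i _ =>
        (hmix.tendsto_zero _ _ (hAk i.1) (hBl i.2)).const_mul ((p : ℝ) ^ (i.1 + i.2))
      simpa [boxAvg] using this
    simpa using h1.add h2

end Joint

end RandomColoring

end

theorem theorem6p6 (d : ℕ) (hd : 1 ≤ d) (p : unitInterval) (hp0 : 0 < p) (hp1 : p < 1)
    (ν : Measure (Setoid (Fin d → ℤ))) [IsProbabilityMeasure ν]
    (hν : RandomColoring.IsStationary RandomColoring.shiftPartition ν)
    (hdens : ν {π | ∃ φ ∈ π.classes, ∃ α : ℝ, 0 < α ∧ RandomColoring.HasDensity φ α} = 0) :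
    (RandomColoring.IsWeaklyMixing RandomColoring.shiftPartition ν ↔
      RandomColoring.IsWeaklyMixing RandomColoring.shiftJoint (RandomColoring.jointLaw p ν)) ∧
    (RandomColoring.IsWeaklyMixing RandomColoring.shiftPartition ν →
      RandomColoring.IsWeaklyMixing RandomColoring.shiftColoring
        (RandomColoring.colorProcess p ν)) := by
  have hjoint := RandomColoring.isWeaklyMixing_jointLaw hp0 hp1 ν hdens
  refine ⟨⟨hjoint, fun h => ?_⟩, fun h => ?_⟩
  · have h1 := h.map measurable_fst (fun x => (hν x).measurable) fun x z => rfl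
    have h2 : (RandomColoring.jointLaw p ν).map Prod.fst = ν :=
      Measure.fst_compProd ν (RandomColoring.colorKernel (Fin d → ℤ) p)
    rwa [h2] at h1
  · exact (hjoint h).map measurable_snd RandomColoring.measurable_shiftColoring fun x z => rfl
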